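/- Let $r_1\ge 2$ and $r_2,r_3\ge 1$ be integers, write $[r]=\{1,\dots,r\}$, and let $S=\mathbb C[p_{ijk} : i\in[r_1],\, j\in[r_2],\, k\in[r_3]]$. The ideal of the conditional independence model $\{X_1\perp X_2\mid X_3,\ X_1\perp X_3\mid X_2\}$ is $$I_{\mathcal M}=(p_{ijk}p_{i'j'k}-p_{ij'k}p_{i'jk} : i,i'\in[r_1],\ j,j'\in[r_2],\ k\in[r_3])+(p_{ijk}p_{i'jk'}-p_{ijk'}p_{i'jk} : i,i'\in[r_1],\ j\in[r_2],\ k,k'\in[r_3]).$$ A subgraph $G$ of the complete bipartite graph $K_{r_2,r_3}$ on $[r_2]\amalg[r_3]$ is called admissible if it has the full vertex set $[r_2]\amalg[r_3]$ and each of its connected components is isomorphic to a complete bipartite graph $K_{a,b}$ with $a,b\ge 1$. For such a $G$ with edge set $E(G)$, let $P_G\subseteq S$ be the ideal generated by all $p_{ijk}$ with $i\in[r_1]$ and $(j,k)\notin E(G)$, together with all $p_{ijk}p_{i'j'k'}-p_{ij'k'}p_{i'jk}$ with $i,i'\in[r_1]$ and with $j,j'\in[r_2]$ and $k,k'\in[r_3]$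 all in the same connected component of $G$. Let $\prec$ be the degree reverse lexicographic term order on $S$ over the variable order in which $p_{ijk}\prec p_{i'j'k'}$ if and only if $(i,j,k)$ precedes $(i',j',k')$ lexicographically (so $p_{111}\prec p_{112}\prec p_{211}$): monomials are compared first by total degree, and of two distinct monomials of the same degree the smaller one is the one with the larger exponent at the $\prec$-smallest variable in which they differ. For an ideal $J$, $\operatorname{in}_\prec J$ denotes the ideal generated by the leading terms of the elements of $J$. **Theorem.** Each $P_G$ with $G$ admissible is prime, and $$I_{\mathcal M}=\bigcap_{G\text{ admissible}}P_G .$$ This primary decomposition is irredundant: no $P_G$ can be omitted from the intersection, and $P_G\not\subseteq P_{G'}$ for distinct admissible $G,G'$. Moreover, $$\operatorname{in}_\prec I_{\mathcal M}=\operatorname{in}_\prec\bigcap_{G}P_G=\bigcap_{G}\operatorname{in}_\prec P_G ,$$ the intersections being over all admissible $G$. Each $\operatorname{in}_\prec P_G$ is a squarefree monomial ideal, and $\operatorname{in}_\prec I_{\mathcal M}$ and $I_{\mathcal M}$ are radical ideals. -/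

import Mathlib

open scoped MonomialOrder

/-- A copy of the exponent vectors `σ →₀ ℕ`, to carry the degree reverse lexicographic order in
which smaller indices are smaller variables. -/
def DegRevLex (σ : Type) : Type := σ →₀ ℕ

namespace DegRevLex

variable {σ : Type}

noncomputable instance : AddCommMonoid (DegRevLex σ) :=
  inferInstanceAs (AddCommMonoid (σ →₀ ℕ))

/-- The sort key: first the total degree, then the reverse of the lexicographic comparison at
the smallest variable. -/
noncomputable def key (a : DegRevLex σ) : ℕ ×ₗ (Lex (σ →₀ ℕ))ᵒᵈ :=
  toLex (Finsupp.degree (R := ℕ) (show σ →₀ ℕ from a), OrderDual.toDual (toLex a))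

theorem key_injective : Function.Injective (key (σ := σ)) := by
  intro a b h
  have h2 := congrArg (fun x => ofLex (OrderDual.ofDual (ofLex x).2)) h
  exact h2

variable [LinearOrder σ]

noncomputable instance : LinearOrder (DegRevLex σ) :=
  LinearOrder.lift' key key_injective

theorem le_iff {a b : DegRevLex σ} :
    a ≤ b ↔ Finsupp.degree (R := ℕ) (show σ →₀ ℕ from a) < Finsupp.degree (show σ →₀ ℕ from b) ∨
      Finsupp.degree (R := ℕ) (show σ →₀ ℕ from a) = Finsupp.degree (show σ →₀ ℕ from b) ∧
        toLex (show σ →₀ ℕ from b) ≤ toLex (show σ →₀ ℕ from a) := by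
  change key a ≤ key b ↔ _
  unfold key
  rw [Prod.Lex.toLex_le_toLex]
  rfl

instance : IsOrderedAddMonoid (DegRevLex σ) where
  add_le_add_left a b h c := by
    rw [le_iff] at h ⊢
    have e : ∀ x : DegRevLex σ, (show σ →₀ ℕ from (x + c)) =
        (show σ →₀ ℕ from x) + (show σ →₀ ℕ from c) := fun _ => rfl
    rw [e, e, map_add, map_add, toLex_add, toLex_add]
    simpa using h

instance [Finite σ] : WellFoundedLT (DegRevLex σ) := by
  let f : DegRevLex σ → ℕ × ℕ := fun a => (Finsupp.degree (R := ℕ) (show σ →₀ ℕ from a),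
    {b : DegRevLex σ | b < a ∧ Finsupp.degree (R := ℕ) (show σ →₀ ℕ from b) =
      Finsupp.degree (show σ →₀ ℕ from a)}.ncard)
  refine ⟨Subrelation.wf (r := InvImage (Prod.Lex (· < ·) (· < ·)) f) ?_
    (InvImage.wf f (WellFounded.prod_lex wellFounded_lt wellFounded_lt))⟩
  intro a b hab
  rcases le_iff.1 hab.le with h | ⟨h, -⟩
  · exact Prod.Lex.left _ _ h
  · change Prod.Lex _ _ (_, _) (_, _)
    rw [Prod.lex_def]
    refine Or.inr ⟨h, Set.ncard_lt_ncard ?_ ?_⟩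
    · refine ⟨fun c hc => ⟨hc.1.trans hab, hc.2.trans h⟩, fun hs => ?_⟩
      exact lt_irrefl _ (hs ⟨hab, h⟩).1
    · exact (Finsupp.finite_of_degree_le (σ := σ)
        (Finsupp.degree (show σ →₀ ℕ from b))).subset fun c hc => le_of_eq hc.2

end DegRevLex

/-- The degree reverse lexicographic monomial order in which smaller indices are smaller
variables: monomials are compared by total degree first; between two distinct monomials of the
same degree, the smaller one is the one with the larger exponent at the smallest variable where
their exponents differ. -/
noncomputable def degRevLex (σ : Type) [LinearOrder σ] [Finite σ] : MonomialOrder σ where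
  syn := DegRevLex σ
  toSyn := { toEquiv := Equiv.refl _, map_add' := fun _ _ => rfl }
  toSyn_monotone a b h := by
    change (show DegRevLex σ from a) ≤ (show DegRevLex σ from b)
    rw [DegRevLex.le_iff]
    have hab : a + (b - a) = b := add_tsub_cancel_of_le h
    rcases eq_or_ne a b with rfl | hne
    · exact Or.inr ⟨rfl, le_rfl⟩
    · left
      change Finsupp.degree a < Finsupp.degree b
      have hd : Finsupp.degree a + Finsupp.degree (b - a) = Finsupp.degree b := by
        rw [← map_add, hab]
      have h0 : Finsupp.degree (b - a) ≠ 0 := by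
        intro h0
        rw [Finsupp.degree_eq_zero_iff] at h0
        rw [h0, add_zero] at hab
        exact hne hab
      omega

/-- The order `degRevLex` in terms of exponents. -/
theorem degRevLex_lt_iff {σ : Type} [LinearOrder σ] [Finite σ] (a b : σ →₀ ℕ) :
    a ≺[degRevLex σ] b ↔ a.degree < b.degree ∨
      a.degree = b.degree ∧ ∃ s, (∀ t, t < s → a t = b t) ∧ b s < a s := by
  rw [← not_le]
  change ¬ ((show DegRevLex σ from b) ≤ (show DegRevLex σ from a)) ↔ _
  rw [DegRevLex.le_iff, not_or, not_and, not_lt, not_le]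
  change a.degree ≤ b.degree ∧ (b.degree = a.degree → toLex b < toLex a) ↔ _
  rw [Finsupp.Lex.lt_iff]
  simp only [ofLex_toLex]
  constructor
  · rintro ⟨h, h'⟩
    rcases h.lt_or_eq with h | h
    · exact Or.inl h
    · obtain ⟨s, hs, hs'⟩ := h' h.symm
      exact Or.inr ⟨h, s, fun t ht => (hs t ht).symm, hs'⟩
  · rintro (h | ⟨h, s, hs, hs'⟩)
    · exact ⟨h.le, fun h' => absurd h' h.ne'⟩
    · exact ⟨h.le, fun _ => ⟨s, fun t ht => (hs t ht).symm, hs'⟩⟩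

/-- The initial ideal of `I` with respect to a monomial order. -/
noncomputable def initialIdeal {σ K : Type} [Field K] (m : MonomialOrder σ)
    (I : Ideal (MvPolynomial σ K)) : Ideal (MvPolynomial σ K) :=
  Ideal.span (m.leadingTerm '' (I : Set (MvPolynomial σ K)))

/-- A squarefree monomial ideal: one generated by products of distinct variables. -/
def IsSquarefreeMonomialIdeal {σ K : Type} [Field K] (I : Ideal (MvPolynomial σ K)) : Prop :=
  ∃ A : Set (Finset σ),
    I = Ideal.span ((fun s : Finset σ => ∏ x ∈ s, (MvPolynomial.X x : MvPolynomial σ K)) '' A)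

namespace CondIndep

/-- Subscripts `(i, j, k)`, ordered lexicographically with earlier entries more significant. -/
abbrev Idx (r₁ r₂ r₃ : ℕ) : Type := Fin r₁ ×ₗ Fin r₂ ×ₗ Fin r₃

variable {r₁ r₂ r₃ : ℕ}

/-- The indeterminate `p_{ijk}` of `S = ℂ[p_{ijk}]`. -/
noncomputable def p (i : Fin r₁) (j : Fin r₂) (k : Fin r₃) : MvPolynomial (Idx r₁ r₂ r₃) ℂ :=
  MvPolynomial.X (toLex (i, toLex (j, k)))

/-- The ideal of the model `{X₁ ⊥ X₂ | X₃, X₁ ⊥ X₃ | X₂}`. -/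
noncomputable def idealM (r₁ r₂ r₃ : ℕ) : Ideal (MvPolynomial (Idx r₁ r₂ r₃) ℂ) :=
  Ideal.span {f | ∃ (i i' : Fin r₁) (j j' : Fin r₂) (k : Fin r₃),
      f = p i j k * p i' j' k - p i j' k * p i' j k} ⊔
  Ideal.span {f | ∃ (i i' : Fin r₁) (j : Fin r₂) (k k' : Fin r₃),
      f = p i j k * p i' j k' - p i j k' * p i' j k}

/-- A spanning subgraph of `K_{r₂,r₃}` all of whose connected components are complete bipartite
graphs with both parts non-empty. -/
def Admissible (G : SimpleGraph (Fin r₂ ⊕ Fin r₃)) : Prop :=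
  G ≤ completeBipartiteGraph (Fin r₂) (Fin r₃) ∧
    ∀ C : G.ConnectedComponent, ∃ a b : ℕ, 1 ≤ a ∧ 1 ≤ b ∧
      Nonempty (C.toSimpleGraph ≃g completeBipartiteGraph (Fin a) (Fin b))

/-- `P⁽⁰⁾_G`, generated by the indeterminates at non-edges. -/
noncomputable def P0 (r₁ : ℕ) (G : SimpleGraph (Fin r₂ ⊕ Fin r₃)) :
    Ideal (MvPolynomial (Idx r₁ r₂ r₃) ℂ) :=
  Ideal.span {f | ∃ (i : Fin r₁) (j : Fin r₂) (k : Fin r₃),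
    ¬ G.Adj (Sum.inl j) (Sum.inr k) ∧ f = p i j k}

/-- `P⁽¹⁾_G`, generated by the `2 × 2` minors belonging to the connected components of `G`. -/
noncomputable def P1 (r₁ : ℕ) (G : SimpleGraph (Fin r₂ ⊕ Fin r₃)) :
    Ideal (MvPolynomial (Idx r₁ r₂ r₃) ℂ) :=
  Ideal.span {f | ∃ (C : G.ConnectedComponent) (i i' : Fin r₁) (j j' : Fin r₂) (k k' : Fin r₃),
    Sum.inl j ∈ C.supp ∧ Sum.inl j' ∈ C.supp ∧ Sum.inr k ∈ C.supp ∧ Sum.inr k' ∈ C.supp ∧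
      f = p i j k * p i' j' k' - p i j' k' * p i' j k}

/-- The ideal `P_G = P⁽⁰⁾_G + P⁽¹⁾_G`. -/
noncomputable def P (r₁ : ℕ) (G : SimpleGraph (Fin r₂ ⊕ Fin r₃)) :
    Ideal (MvPolynomial (Idx r₁ r₂ r₃) ℂ) :=
  P0 r₁ G ⊔ P1 r₁ G

end CondIndep

/-! Index the variables by a row `i` and a column `v = (j, k)`. For admissible `G`, `P_G` kills the
columns at non-edges and imposes rank at most one on the columns of each component. It is the kernel
of the map sending `x_{i,v}` to `0` at non-edges and to `s_{i,χ(v)} t_v` otherwise, so it is prime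
(`labelIdeal_eq_ker`). A monomial with no killed column and no antidiagonal within a component is
the smallest one with its image, so the killed variables and the antidiagonals generate the initial
ideal.

It remains to show that a monomial `u` which is leading for every `P_G` is leading for `I_M`
(`exists_mem_idealM_leadingTerm`). Let `E` be the set of columns occurring in `u`, two being linked
when they share `j` or `k`. Some admissible `G` contains `E` as edges without merging its linked
classes (`exists_label`). For this `G`, `u` has an antidiagonal on two columns of one class, and
exchanging rows along a chain in `E` (`exchange_mem`) puts the corresponding multiple of a minor,
with leading term `u`, in `I_M`. Since `I_M` lies in the intersection, the ideals and their initial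
ideals coincide. -/

/-! ### Leading exponents and squarefree monomial ideals -/

section LeadingExponents

open MvPolynomial

variable {σ K : Type} [Field K] {m : MonomialOrder σ}

/-- An ideal containing, for each leading exponent of a larger ideal, a polynomial with that
leading term is equal to the larger ideal. -/
theorem le_of_leadingTerm_eq_monomial {B : Set (σ →₀ ℕ)} {I J : Ideal (MvPolynomial σ K)}
    (hIJ : I ≤ J) (hJ : ∀ f ∈ J, f ≠ 0 → m.degree f ∈ B)
    (hI : ∀ u ∈ B, ∃ g ∈ I, m.leadingTerm g = monomial u 1) : J ≤ I := by
  intro f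
  induction hd : m.toSyn (m.degree f) using WellFoundedLT.induction generalizing f with
  | ind d ih =>
    intro hf
    by_cases hf0 : f = 0
    · rw [hf0]; exact I.zero_mem
    obtain ⟨g, hg, hgt⟩ := hI _ (hJ f hf hf0)
    have hlt : m.leadingTerm (C (m.leadingCoeff f) * g) = m.leadingTerm f := by
      rw [m.leadingTerm_mul, m.leadingTerm_C, hgt, MonomialOrder.C_mul_leadingCoeff_monomial_degree]
    rw [MonomialOrder.leadingTerm_eq_leadingTerm_iff] at hlt
    set g' := C (m.leadingCoeff f) * g with hg'
    have hg'I : g' ∈ I := I.mul_mem_left _ hg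
    have hsub : f - g' ∈ I := by
      by_cases h0 : f - g' = 0
      · rw [h0]; exact I.zero_mem
      refine ih _ ?_ rfl (J.sub_mem hf (hIJ hg'I))
      rw [← hd]
      refine lt_of_le_of_ne ((m.degree_sub_le).trans (by rw [hlt.2, sup_idem])) fun h => h0 ?_
      rw [← m.leadingCoeff_eq_zero_iff, MonomialOrder.leadingCoeff, m.toSyn.injective h, coeff_sub]
      nth_rewrite 2 [← hlt.2]
      rw [sub_eq_zero]
      exact hlt.1.symm
    simpa using I.add_mem hsub hg'I

/-- The ideal whose elements are the combinations of monomials with support in `B`. -/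
noncomputable def squarefreeIdeal (K : Type) [Field K] (B : Set (Finset σ)) :
    Ideal (MvPolynomial σ K) :=
  Ideal.span ((fun u : σ →₀ ℕ => monomial u (1 : K)) '' {u | u.support ∈ B})

theorem mem_squarefreeIdeal {B : Set (Finset σ)} (hB : IsUpperSet B) {f : MvPolynomial σ K} :
    f ∈ squarefreeIdeal K B ↔ ∀ u ∈ f.support, u.support ∈ B := by
  rw [squarefreeIdeal, mem_ideal_span_monomial_image]
  refine forall₂_congr fun u _ => ⟨?_, fun h => ⟨u, h, le_rfl⟩⟩
  rintro ⟨w, hw, hwu⟩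
  exact hB (Finsupp.support_mono hwu) hw

theorem isSquarefreeMonomialIdeal_squarefreeIdeal (B : Set (Finset σ)) :
    IsSquarefreeMonomialIdeal (squarefreeIdeal K B) := by
  classical
  have key : ∀ s : Finset σ, (∏ x ∈ s, (X x : MvPolynomial σ K)) =
      monomial (∑ x ∈ s, Finsupp.single x 1) 1 := by
    intro s
    rw [monomial_sum_one]
    rfl
  have hval : ∀ (s : Finset σ) (x : σ), (∑ y ∈ s, Finsupp.single y 1 : σ →₀ ℕ) x =
      if x ∈ s then 1 else 0 := by
    intro s x
    simp [Finsupp.finsetSum_apply, Finsupp.single_apply]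
  refine ⟨B, le_antisymm (Ideal.span_le.2 ?_) (Ideal.span_mono ?_)⟩
  · rintro _ ⟨u, hu, rfl⟩
    have hle : (∑ y ∈ u.support, Finsupp.single y 1 : σ →₀ ℕ) ≤ u := by
      intro x
      rw [hval]
      split_ifs with h
      · exact Nat.one_le_iff_ne_zero.2 (Finsupp.mem_support_iff.1 h)
      · exact Nat.zero_le _
    refine Ideal.mem_of_dvd _ ?_ (Ideal.subset_span ⟨u.support, hu, rfl⟩)
    change (∏ x ∈ u.support, X x) ∣ _
    rw [key, monomial_dvd_monomial]
    exact ⟨Or.inr hle, one_dvd _⟩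
  · rintro _ ⟨s, hs, rfl⟩
    refine ⟨∑ y ∈ s, Finsupp.single y 1, ?_, (key s).symm⟩
    have : (∑ y ∈ s, Finsupp.single y 1 : σ →₀ ℕ).support = s := by
      ext x
      rw [Finsupp.mem_support_iff, hval]
      simp
    change Finsupp.support _ ∈ B
    rwa [this]

/-- A power of `f` has as leading exponent a multiple of that of `f`, with no larger support, so the
leading term of `f` lies in the ideal. It is subtracted, and induction applies; the order `m` serves
only this induction. -/
theorem isRadical_squarefreeIdeal (m : MonomialOrder σ) {B : Set (Finset σ)} (hB : IsUpperSet B) :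
    (squarefreeIdeal K B).IsRadical := by
  intro f
  induction hd : m.toSyn (m.degree f) using WellFoundedLT.induction generalizing f with
  | ind d ih =>
    rintro ⟨n, hn⟩
    by_cases hf0 : f = 0
    · rw [hf0]; exact Ideal.zero_mem _
    have hdeg : (m.degree f).support ∈ B := by
      have h := (mem_squarefreeIdeal hB).1 hn _ (m.degree_mem_support (pow_ne_zero n hf0))
      rw [m.degree_pow] at h
      exact hB (fun x hx => by
        rw [Finsupp.mem_support_iff] at hx ⊢
        intro h0
        simp [h0] at hx) h
    have hlt : m.leadingTerm f ∈ squarefreeIdeal K B := by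
      rw [mem_squarefreeIdeal hB, m.support_leadingTerm' hf0]
      simpa using hdeg
    have hsub : f - m.leadingTerm f ∈ squarefreeIdeal K B := by
      by_cases h0 : m.degree f = 0
      · have : f - m.leadingTerm f = 0 := by
          rw [MonomialOrder.leadingTerm, h0, MonomialOrder.leadingCoeff, h0,
            MonomialOrder.eq_C_of_degree_eq_zero h0, MonomialOrder.leadingCoeff, h0]
          simp
        rw [this]
        exact Ideal.zero_mem _
      · refine ih _ ?_ rfl ?_
        · rw [← hd]
          exact MonomialOrder.degree_sub_leadingTerm_lt_degree h0
        · exact Ideal.sub_mem (squarefreeIdeal K B).radical ⟨n, hn⟩ (Ideal.le_radical hlt)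
    simpa using Ideal.add_mem _ hsub hlt

theorem initialIdeal_eq_squarefreeIdeal {B : Set (Finset σ)} {J : Ideal (MvPolynomial σ K)}
    (hJ : ∀ f ∈ J, f ≠ 0 → (m.degree f).support ∈ B)
    (hB : ∀ u : σ →₀ ℕ, u.support ∈ B → ∃ g ∈ J, m.leadingTerm g = monomial u 1) :
    initialIdeal m J = squarefreeIdeal K B := by
  refine le_antisymm (Ideal.span_le.2 ?_) (Ideal.span_mono ?_)
  · rintro _ ⟨f, hf, rfl⟩
    by_cases hf0 : f = 0
    · rw [hf0, m.leadingTerm_zero]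
      exact Ideal.zero_mem _
    · rw [← MonomialOrder.C_mul_leadingCoeff_monomial_degree]
      exact Ideal.mul_mem_left _ _ (Ideal.subset_span ⟨_, hJ f hf hf0, rfl⟩)
  · rintro _ ⟨u, hu, rfl⟩
    obtain ⟨g, hg, hgu⟩ := hB u hu
    exact ⟨g, hg, hgu⟩

theorem leadingTerm_monomial_sub_monomial {u w : σ →₀ ℕ} (h : w ≺[m] u) :
    m.leadingTerm (monomial u (1 : K) - monomial w 1) = monomial u 1 := by
  classical
  have hd : ∀ u : σ →₀ ℕ, m.degree (monomial u (1 : K)) = u := fun u => by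
    rw [m.degree_monomial, if_neg one_ne_zero]
  have h' : m.degree (monomial w (1 : K)) ≺[m] m.degree (monomial u (1 : K)) := by
    rwa [hd, hd]
  rw [MonomialOrder.leadingTerm, m.degree_sub_of_lt h', m.leadingCoeff_sub_of_lt h', hd,
    m.leadingCoeff_monomial]

end LeadingExponents

/-! ### Ideals of matrices with rank at most one on each label -/

section LabelIdeal

open MvPolynomial

variable {K : Type} [Field K] {R V γ : Type}

theorem exists_leadingTerm_antidiagonal [LinearOrder R] [LinearOrder V] [Fintype R] [Fintype V]
    {i i' : R} {a b : V} (hi : i < i') (hab : a < b)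
    {u : R ×ₗ V →₀ ℕ} (h₁ : u (toLex (i, b)) ≠ 0) (h₂ : u (toLex (i', a)) ≠ 0) :
    ∃ M : R ×ₗ V →₀ ℕ,
      u = M + (Finsupp.single (toLex (i, b)) 1 + Finsupp.single (toLex (i', a)) 1) ∧
      (degRevLex (R ×ₗ V)).leadingTerm (monomial M (1 : K) *
        (X (toLex (i, b)) * X (toLex (i', a)) - X (toLex (i, a)) * X (toLex (i', b)))) =
          monomial u 1 := by
  classical
  have hne : toLex (i, b) ≠ toLex (i', a) := by simp [hi.ne]
  have hle : Finsupp.single (toLex (i, b)) 1 + Finsupp.single (toLex (i', a)) 1 ≤ u := by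
    intro x
    rw [Finsupp.add_apply, Finsupp.single_apply, Finsupp.single_apply]
    split_ifs with h h' h'
    · exact absurd (h.trans h'.symm) hne
    · rw [← h]; omega
    · rw [← h']; omega
    · omega
  obtain ⟨M, hM⟩ := exists_add_of_le hle
  refine ⟨M, by rw [hM, add_comm], ?_⟩
  have hX : ∀ x y : R ×ₗ V, monomial M (1 : K) * (X x * X y) =
      monomial (M + (Finsupp.single x 1 + Finsupp.single y 1)) 1 := by
    intro x y
    rw [X, X, monomial_mul, monomial_mul, one_mul, one_mul]
  rw [mul_sub, hX, hX, leadingTerm_monomial_sub_monomial, add_comm M, ← hM]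
  rw [degRevLex_lt_iff]
  -- The smallest of the four variables, `(i, a)`, occurs only in the diagonal product, which is
  -- therefore the smaller one.
  refine Or.inr ⟨?_, toLex (i, a), fun t ht => ?_, ?_⟩
  · simp [Finsupp.degree_single]
  · have h1 : t ≠ toLex (i, a) := ht.ne
    have h2 : t ≠ toLex (i, b) := (ht.trans (Prod.Lex.right _ hab)).ne
    have h3 : t ≠ toLex (i', a) := (ht.trans (Prod.Lex.left _ _ hi)).ne
    have h4 : t ≠ toLex (i', b) := (ht.trans (Prod.Lex.left _ _ hi)).ne
    simp [h1.symm, h2.symm, h3.symm, h4.symm]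
  · simp [hab.ne', hi.ne']

/-- The ideal generated by the variables in the columns of `Z` and by the `2 × 2` minors on pairs
of equally labelled columns outside `Z`. -/
noncomputable def labelIdeal (K R : Type) [Field K] (χ : V → γ) (Z : Set V) :
    Ideal (MvPolynomial (R ×ₗ V) K) :=
  Ideal.span {f | ∃ (i : R) (v : V), v ∈ Z ∧ f = X (toLex (i, v))} ⊔
  Ideal.span {f | ∃ (i i' : R) (v w : V), v ∉ Z ∧ w ∉ Z ∧ χ v = χ w ∧
    f = X (toLex (i, v)) * X (toLex (i', w)) - X (toLex (i, w)) * X (toLex (i', v))}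

/-- The supports of the leading exponents of `labelIdeal`. -/
def labelSupports [LinearOrder R] [LinearOrder V] (χ : V → γ) (Z : Set V) :
    Set (Finset (R ×ₗ V)) :=
  {s | (∃ x ∈ s, (ofLex x).2 ∈ Z) ∨ ∃ (i i' : R) (a b : V), i < i' ∧ a < b ∧ a ∉ Z ∧ b ∉ Z ∧
    χ a = χ b ∧ toLex (i, b) ∈ s ∧ toLex (i', a) ∈ s}

theorem isUpperSet_labelSupports [LinearOrder R] [LinearOrder V] (χ : V → γ) (Z : Set V) :
    IsUpperSet (labelSupports (R := R) χ Z) := by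
  rintro s t hst (⟨x, hx, hxZ⟩ | ⟨i, i', a, b, hi, hab, ha, hb, hχ, h₁, h₂⟩)
  · exact Or.inl ⟨x, hst hx, hxZ⟩
  · exact Or.inr ⟨i, i', a, b, hi, hab, ha, hb, hχ, hst h₁, hst h₂⟩

/-- The exponent of the image of the variable `x` in the parametrization of the zero set of a
`labelIdeal`. -/
noncomputable def varWeight (χ : V → γ) (x : R ×ₗ V) : (R × γ) ⊕ V →₀ ℕ :=
  Finsupp.single (Sum.inl ((ofLex x).1, χ (ofLex x).2)) 1 + Finsupp.single (Sum.inr (ofLex x).2) 1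

/-- The linear extension of `varWeight` to exponents. -/
noncomputable def labelWeight (χ : V → γ) (u : R ×ₗ V →₀ ℕ) : (R × γ) ⊕ V →₀ ℕ :=
  u.sum fun x n => n • varWeight χ x

open Classical in
/-- The parametrization with kernel `labelIdeal K R χ Z`. -/
noncomputable def labelHom (K R : Type) [Field K] (χ : V → γ) (Z : Set V) :
    MvPolynomial (R ×ₗ V) K →ₐ[K] MvPolynomial ((R × γ) ⊕ V) K :=
  aeval fun x => if (ofLex x).2 ∈ Z then 0 else monomial (varWeight χ x) 1

theorem labelHom_X_of_mem (χ : V → γ) {Z : Set V} (i : R) {v : V} (hv : v ∈ Z) :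
    labelHom K R χ Z (X (toLex (i, v))) = 0 := by
  simp [labelHom, hv]

theorem labelHom_X_of_notMem (χ : V → γ) {Z : Set V} (i : R) {v : V} (hv : v ∉ Z) :
    labelHom K R χ Z (X (toLex (i, v))) = X (Sum.inl (i, χ v)) * X (Sum.inr v) := by
  rw [labelHom, aeval_X, if_neg (by exact hv), X, X, monomial_mul, one_mul]
  rfl

theorem labelHom_monomial_eq_zero (χ : V → γ) {Z : Set V} {u : R ×ₗ V →₀ ℕ} (c : K)
    (hu : ∃ x ∈ u.support, (ofLex x).2 ∈ Z) : labelHom K R χ Z (monomial u c) = 0 := by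
  obtain ⟨x, hx, hxZ⟩ := hu
  rw [labelHom, aeval_monomial, Finsupp.prod, Finset.prod_eq_zero hx, mul_zero]
  rw [if_pos hxZ, zero_pow (Finsupp.mem_support_iff.1 hx)]

open Classical in
theorem labelHom_monomial (χ : V → γ) {Z : Set V} {u : R ×ₗ V →₀ ℕ} (c : K)
    (hu : ∀ x ∈ u.support, (ofLex x).2 ∉ Z) :
    labelHom K R χ Z (monomial u c) = monomial (labelWeight χ u) c := by
  rw [labelHom, aeval_monomial, Finsupp.prod, labelWeight, Finsupp.sum]
  have : ∀ x ∈ u.support, (if (ofLex x).2 ∈ Z then (0 : MvPolynomial ((R × γ) ⊕ V) K) else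
      monomial (varWeight χ x) 1) ^ u x = monomial (u x • varWeight χ x) 1 := by
    intro x hx
    rw [if_neg (hu x hx), monomial_pow, one_pow]
  rw [Finset.prod_congr rfl this, ← monomial_sum_one, algebraMap_eq, C_mul_monomial, mul_one]

theorem labelIdeal_le_ker (χ : V → γ) (Z : Set V) :
    labelIdeal K R χ Z ≤ RingHom.ker (labelHom K R χ Z) := by
  refine sup_le (Ideal.span_le.2 ?_) (Ideal.span_le.2 ?_)
  · rintro _ ⟨i, v, hv, rfl⟩
    exact labelHom_X_of_mem χ i hv
  · rintro _ ⟨i, i', v, w, hv, hw, hχ, rfl⟩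
    change labelHom K R χ Z _ = 0
    rw [map_sub, map_mul, map_mul, labelHom_X_of_notMem χ i hv, labelHom_X_of_notMem χ i' hw,
      labelHom_X_of_notMem χ i hw, labelHom_X_of_notMem χ i' hv, hχ]
    ring

theorem labelWeight_inr [Fintype R] [Fintype V] [DecidableEq V] (χ : V → γ) (u : R ×ₗ V →₀ ℕ)
    (v : V) :
    labelWeight χ u (Sum.inr v) = ∑ x : R ×ₗ V, if (ofLex x).2 = v then u x else 0 := by
  classical
  rw [labelWeight, Finsupp.sum_fintype _ _ (by simp), Finsupp.finsetSum_apply]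
  refine Finset.sum_congr rfl fun x _ => ?_
  simp [varWeight, Finsupp.single_apply]

theorem labelWeight_inl [Fintype R] [Fintype V] [DecidableEq R] [DecidableEq γ] (χ : V → γ)
    (u : R ×ₗ V →₀ ℕ) (i : R) (c : γ) :
    labelWeight χ u (Sum.inl (i, c)) =
      ∑ x : R ×ₗ V, if (ofLex x).1 = i ∧ χ (ofLex x).2 = c then u x else 0 := by
  classical
  rw [labelWeight, Finsupp.sum_fintype _ _ (by simp), Finsupp.finsetSum_apply]
  refine Finset.sum_congr rfl fun x _ => ?_
  simp [varWeight, Finsupp.single_apply]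

theorem exists_lt_of_sum_ite_eq {α : Type} [Fintype α] {q : α → Prop} [DecidablePred q]
    {u w : α → ℕ} (h : (∑ x, if q x then u x else 0) = ∑ x, if q x then w x else 0)
    {y : α} (hy : q y) (hlt : u y < w y) : ∃ x, q x ∧ w x < u x := by
  by_contra! hcon
  refine h.not_lt (Finset.sum_lt_sum (fun x _ => ?_) ⟨y, Finset.mem_univ _, ?_⟩)
  · split_ifs with hx
    · exact hcon x hx
    · exact le_rfl
  · simpa [hy] using hlt

theorem degree_eq_of_labelWeight_eq [Fintype R] [Fintype V] {χ : V → γ} {u w : R ×ₗ V →₀ ℕ}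
    (h : labelWeight χ u = labelWeight χ w) : u.degree = w.degree := by
  classical
  have key : ∀ u : R ×ₗ V →₀ ℕ, u.degree = ∑ v : V, labelWeight χ u (Sum.inr v) := by
    intro u
    simp_rw [labelWeight_inr]
    rw [Finset.sum_comm, Finsupp.degree_eq_sum]
    simp
  rw [key, key, h]

variable [LinearOrder R] [LinearOrder V]

/-- A monomial without antidiagonals is smallest among those with the same column sums and the
same row sums on each label. -/
theorem eq_of_labelWeight_eq [Fintype R] [Fintype V] {χ : V → γ} {Z : Set V} {u w : R ×ₗ V →₀ ℕ}
    (hu : u.support ∉ labelSupports χ Z) (h : labelWeight χ w = labelWeight χ u)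
    (hwu : w ≼[degRevLex (R ×ₗ V)] u) : w = u := by
  classical
  by_contra hne
  have hlt : w ≺[degRevLex (R ×ₗ V)] u :=
    lt_of_le_of_ne hwu fun h' => hne ((degRevLex (R ×ₗ V)).toSyn.injective h')
  rw [degRevLex_lt_iff] at hlt
  rcases hlt with hlt | ⟨-, s, hs, hsu⟩
  · exact hlt.ne (degree_eq_of_labelWeight_eq h)
  obtain ⟨⟨i, v⟩, rfl⟩ := toLex.surjective s
  -- At `s`, the first difference, the smaller monomial `w` has the larger exponent; hence every
  -- deficit of `w` lies beyond `s`.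
  have hgt : ∀ x, w x < u x → toLex (i, v) < x := fun x hx => by
    rcases lt_trichotomy (toLex (i, v)) x with h | h | h
    · exact h
    · subst h; omega
    · have := hs x h; omega
  have hc := congrArg (fun f => f (Sum.inr v)) h
  have hr := congrArg (fun f => f (Sum.inl (i, χ v))) h
  simp only [labelWeight_inr, labelWeight_inl] at hc hr
  -- The excess of `w` at `s` is balanced by a deficit in the same column, hence in a later row, and
  -- by one in the same row and label, hence in a later column. Both positions occur in `u` and form
  -- an antidiagonal.
  obtain ⟨x, hxv, hx⟩ := exists_lt_of_sum_ite_eq hc.symm (y := toLex (i, v)) rfl hsu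
  obtain ⟨y, ⟨hyi, hyχ⟩, hy⟩ := exists_lt_of_sum_ite_eq hr.symm (y := toLex (i, v)) ⟨rfl, rfl⟩ hsu
  obtain ⟨⟨i', v'⟩, rfl⟩ := toLex.surjective x
  obtain ⟨⟨i'', b⟩, rfl⟩ := toLex.surjective y
  have hx' := hgt _ hx
  have hy' := hgt _ hy
  rw [Prod.Lex.toLex_lt_toLex] at hx' hy'
  simp only [ofLex_toLex] at hxv hyi hyχ hx' hy'
  subst hxv hyi
  have hi : i'' < i' := by simpa using hx'
  have hb : v' < b := by simpa using hy'
  have hxs : toLex (i', v') ∈ u.support := Finsupp.mem_support_iff.2 (by omega)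
  have hys : toLex (i'', b) ∈ u.support := Finsupp.mem_support_iff.2 (by omega)
  exact hu (Or.inr ⟨i'', i', v', b, hi, hb, fun hz => hu (Or.inl ⟨_, hxs, hz⟩),
    fun hz => hu (Or.inl ⟨_, hys, hz⟩), hyχ.symm, hys, hxs⟩)

/-- Otherwise no other monomial of `f` has the same nonzero image as the leading one, whose
coefficient then survives in the image of `f`. -/
theorem support_degree_mem_labelSupports [Fintype R] [Fintype V] {χ : V → γ} {Z : Set V}
    {f : MvPolynomial (R ×ₗ V) K} (hf : f ∈ RingHom.ker (labelHom K R χ Z)) (hf0 : f ≠ 0) :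
    ((degRevLex (R ×ₗ V)).degree f).support ∈ labelSupports χ Z := by
  classical
  by_contra hu
  set u := (degRevLex (R ×ₗ V)).degree f with hudef
  have huZ : ∀ x ∈ u.support, (ofLex x).2 ∉ Z := fun x hx hz => hu (Or.inl ⟨x, hx, hz⟩)
  have h0 : coeff (labelWeight χ u) (labelHom K R χ Z f) = 0 := by
    rw [RingHom.mem_ker.1 hf, coeff_zero]
  rw [f.as_sum, map_sum, coeff_sum, Finset.sum_eq_single u] at h0
  · rw [labelHom_monomial χ _ huZ, coeff_monomial, if_pos rfl] at h0
    exact hf0 ((degRevLex (R ×ₗ V)).coeff_degree_eq_zero_iff.1 h0)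
  · intro w hw hwu
    by_cases hwZ : ∃ x ∈ w.support, (ofLex x).2 ∈ Z
    · rw [labelHom_monomial_eq_zero χ _ hwZ, coeff_zero]
    · push Not at hwZ
      rw [labelHom_monomial χ _ hwZ, coeff_monomial, if_neg]
      exact fun h => hwu (eq_of_labelWeight_eq hu h ((degRevLex (R ×ₗ V)).le_degree hw))
  · intro h
    exact absurd ((degRevLex (R ×ₗ V)).degree_mem_support hf0) h

theorem exists_mem_labelIdeal_leadingTerm [Fintype R] [Fintype V] {χ : V → γ} {Z : Set V}
    {u : R ×ₗ V →₀ ℕ} (hu : u.support ∈ labelSupports χ Z) :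
    ∃ g ∈ labelIdeal K R χ Z, (degRevLex (R ×ₗ V)).leadingTerm g = monomial u 1 := by
  rcases hu with ⟨x, hx, hxZ⟩ | ⟨i, i', a, b, hi, hab, ha, hb, hχ, h₁, h₂⟩
  · refine ⟨monomial u 1, ?_, MonomialOrder.leadingTerm_monomial _ _⟩
    refine Ideal.mem_of_dvd _ (X_dvd_monomial.2 (Or.inr (Finsupp.mem_support_iff.1 hx))) ?_
    exact Ideal.mem_sup_left (Ideal.subset_span ⟨(ofLex x).1, (ofLex x).2, hxZ, rfl⟩)
  · obtain ⟨M, -, hM⟩ := exists_leadingTerm_antidiagonal (K := K) hi hab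
      (Finsupp.mem_support_iff.1 h₁) (Finsupp.mem_support_iff.1 h₂)
    exact ⟨_, Ideal.mul_mem_left _ _ (Ideal.mem_sup_right (Ideal.subset_span
      ⟨i, i', b, a, hb, ha, hχ.symm, rfl⟩)), hM⟩

theorem labelIdeal_eq_ker [Fintype R] [Fintype V] (χ : V → γ) (Z : Set V) :
    labelIdeal K R χ Z = RingHom.ker (labelHom K R χ Z) :=
  le_antisymm (labelIdeal_le_ker χ Z) (le_of_leadingTerm_eq_monomial (labelIdeal_le_ker χ Z)
    (fun _ hf hf0 => support_degree_mem_labelSupports hf hf0)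
    fun _ hu => exists_mem_labelIdeal_leadingTerm hu)

theorem isPrime_labelIdeal [Fintype R] [Fintype V] (χ : V → γ) (Z : Set V) :
    (labelIdeal K R χ Z).IsPrime := by
  rw [labelIdeal_eq_ker]
  exact RingHom.ker_isPrime _

theorem initialIdeal_labelIdeal [Fintype R] [Fintype V] (χ : V → γ) (Z : Set V) :
    initialIdeal (degRevLex (R ×ₗ V)) (labelIdeal K R χ Z) =
      squarefreeIdeal K (labelSupports χ Z) :=
  initialIdeal_eq_squarefreeIdeal
    (fun _ hf hf0 => support_degree_mem_labelSupports (labelIdeal_le_ker χ Z hf) hf0)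
    fun _ hu => exists_mem_labelIdeal_leadingTerm hu

end LabelIdeal

/-! ### Exchanging rows along chains of columns -/

section Exchange

open MvPolynomial

variable {K : Type} [Field K] {R V : Type}

/-- If the columns of `E` all occur in a monomial, and an ideal contains the `2 × 2` minors on
related columns, then modulo that ideal rows may be exchanged between connected columns. -/
theorem exchange_mem {I : Ideal (MvPolynomial (R ×ₗ V) K)} {E : Set V} {r : V → V → Prop}
    (hrE : ∀ a b, r a b → a ∈ E ∧ b ∈ E)
    (hI : ∀ a b, r a b → ∀ i i' : R,
      X (toLex (i, a)) * X (toLex (i', b)) - X (toLex (i, b)) * X (toLex (i', a)) ∈ I)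
    {a b : V} (hab : Relation.EqvGen r a b) :
    (a ∈ E ↔ b ∈ E) ∧ (a ∈ E → ∀ (M : R ×ₗ V →₀ ℕ) (i i' : R),
      (∀ e ∈ E, e = a ∨ e = b ∨ ∃ l, M (toLex (l, e)) ≠ 0) →
      monomial M (1 : K) * (X (toLex (i, a)) * X (toLex (i', b)) -
        X (toLex (i, b)) * X (toLex (i', a))) ∈ I) := by
  classical
  induction hab with
  | rel a b h =>
    exact ⟨iff_of_true (hrE a b h).1 (hrE a b h).2,
      fun _ M i i' _ => I.mul_mem_left _ (hI a b h i i')⟩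
  | refl a =>
    refine ⟨Iff.rfl, fun _ M i i' _ => ?_⟩
    rw [sub_self, mul_zero]
    exact I.zero_mem
  | symm a b _ ih =>
    refine ⟨ih.1.symm, fun hb M i i' hM => ?_⟩
    have h := ih.2 (ih.1.2 hb) M i' i fun e he => or_left_comm.1 (hM e he)
    rwa [mul_comm (X (toLex (i', a))), mul_comm (X (toLex (i', b)))] at h
  | trans a b c _ _ ih₁ ih₂ =>
    refine ⟨ih₁.1.trans ih₂.1, fun ha M i i' hM => ?_⟩
    have hb := ih₁.1.1 ha
    -- If `b` is `a` or `c`, it need not occur in `M`; otherwise it does, and a variable `x_{l,b}`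
    -- can be split off.
    rcases eq_or_ne b a with rfl | hba
    · exact ih₂.2 hb M i i' hM
    rcases eq_or_ne b c with rfl | hbc
    · exact ih₁.2 ha M i i' hM
    obtain ⟨l, hl⟩ := ((hM b hb).resolve_left hba).resolve_left hbc
    obtain ⟨N, rfl⟩ : ∃ N, M = N + Finsupp.single (toLex (l, b)) 1 := by
      refine ⟨M - Finsupp.single (toLex (l, b)) 1, (tsub_add_cancel_of_le ?_).symm⟩
      rw [Finsupp.single_le_iff]
      omega
    have hN : ∀ e ∈ E, e = a ∨ e = b ∨ e = c ∨ ∃ k, N (toLex (k, e)) ≠ 0 := by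
      intro e he
      by_cases heb : e = b
      · exact Or.inr (Or.inl heb)
      rcases hM e he with h | h | ⟨k, hk⟩
      · exact Or.inl h
      · exact Or.inr (Or.inr (Or.inl h))
      · refine Or.inr (Or.inr (Or.inr ⟨k, ?_⟩))
        have hne : toLex (l, b) ≠ toLex (k, e) := by
          simpa using fun _ => Ne.symm heb
        rwa [Finsupp.add_apply, Finsupp.single_apply, if_neg hne, add_zero] at hk
    have hX : ∀ x : R ×ₗ V, monomial (N + Finsupp.single x 1) (1 : K) = monomial N 1 * X x := by
      intro x
      rw [X, monomial_mul, one_mul]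
    -- With `[pq|vw] = x_{pv} x_{qw} - x_{pw} x_{qv}`, the identity used is `x_{lb} [ii'|ac] =
    -- x_{i'c} [il|ab] + x_{la} [ii'|bc] + x_{ic} [li'|ab]`. The multiplier in each summand supplies
    -- the column missing from its minor.
    have h₁ := ih₁.2 ha (N + Finsupp.single (toLex (i', c)) 1) i l fun e he => by
      rcases hN e he with h | h | rfl | ⟨k, hk⟩
      · exact Or.inl h
      · exact Or.inr (Or.inl h)
      · exact Or.inr (Or.inr ⟨i', by simp⟩)
      · exact Or.inr (Or.inr ⟨k, by simp [hk]⟩)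
    have h₂ := ih₂.2 hb (N + Finsupp.single (toLex (l, a)) 1) i i' fun e he => by
      rcases hN e he with rfl | h | h | ⟨k, hk⟩
      · exact Or.inr (Or.inr ⟨l, by simp⟩)
      · exact Or.inl h
      · exact Or.inr (Or.inl h)
      · exact Or.inr (Or.inr ⟨k, by simp [hk]⟩)
    have h₃ := ih₁.2 ha (N + Finsupp.single (toLex (i, c)) 1) l i' fun e he => by
      rcases hN e he with h | h | rfl | ⟨k, hk⟩
      · exact Or.inl h
      · exact Or.inr (Or.inl h)
      · exact Or.inr (Or.inr ⟨i, by simp⟩)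
      · exact Or.inr (Or.inr ⟨k, by simp [hk]⟩)
    rw [hX] at h₁ h₂ h₃ ⊢
    convert I.add_mem (I.add_mem h₁ h₂) h₃ using 1
    ring

end Exchange

/-! ### Variables and minors in a label ideal -/

section LabelIdealMembership

open MvPolynomial

variable {K : Type} [Field K] {R V γ : Type}

theorem minor_mem_labelIdeal {χ : V → γ} {Z : Set V} {v w : V}
    (h : v ∉ Z → w ∉ Z → χ v = χ w) (i i' : R) :
    X (toLex (i, v)) * X (toLex (i', w)) - X (toLex (i, w)) * X (toLex (i', v)) ∈
      labelIdeal K R χ Z := by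
  have hX : ∀ (i : R) (v : V), v ∈ Z → X (toLex (i, v)) ∈ labelIdeal K R χ Z :=
    fun i v hv => Ideal.mem_sup_left (Ideal.subset_span ⟨i, v, hv, rfl⟩)
  by_cases hv : v ∈ Z
  · exact sub_mem (Ideal.mul_mem_right _ _ (hX i v hv)) (Ideal.mul_mem_left _ _ (hX i' v hv))
  by_cases hw : w ∈ Z
  · exact sub_mem (Ideal.mul_mem_left _ _ (hX i' w hw)) (Ideal.mul_mem_right _ _ (hX i w hw))
  exact Ideal.mem_sup_right (Ideal.subset_span ⟨i, i', v, w, hv, hw, h hv hw, rfl⟩)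

theorem mem_of_X_mem_labelIdeal {χ : V → γ} {Z : Set V} {i : R} {v : V}
    (h : X (toLex (i, v)) ∈ labelIdeal K R χ Z) : v ∈ Z := by
  by_contra hv
  have h0 := labelIdeal_le_ker χ Z h
  rw [RingHom.mem_ker, labelHom_X_of_notMem χ i hv] at h0
  exact mul_ne_zero (X_ne_zero _) (X_ne_zero _) h0

theorem label_eq_of_minor_mem_labelIdeal {χ : V → γ} {Z : Set V} {i i' : R} (hi : i ≠ i')
    {v w : V} (hv : v ∉ Z) (hw : w ∉ Z)
    (h : X (toLex (i, v)) * X (toLex (i', w)) - X (toLex (i, w)) * X (toLex (i', v)) ∈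
      labelIdeal K R χ Z) : χ v = χ w := by
  classical
  by_contra hχ
  have h0 := labelIdeal_le_ker χ Z h
  rw [RingHom.mem_ker, map_sub, map_mul, map_mul, labelHom_X_of_notMem χ i hv,
    labelHom_X_of_notMem χ i' hw, labelHom_X_of_notMem χ i hw, labelHom_X_of_notMem χ i' hv] at h0
  -- At this point the second product of the image vanishes and the first equals `1`.
  let e : (R × γ) ⊕ V → K := fun x => if x = Sum.inl (i, χ w) then 0 else 1
  have h1 := congrArg (eval e) h0
  simp [e, hi.symm, hχ] at h1

end LabelIdealMembership

/-! ### Admissible graphs as label classes -/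

namespace CondIndep

open MvPolynomial

variable {r₁ r₂ r₃ : ℕ}

/-- The isomorphism `φ` need not respect the two sides. If it sent both vertices to one part, they
would have a common neighbour, impossible for vertices on opposite sides of `K_{r₂,r₃}`. -/
theorem Admissible.adj_of_reachable {G : SimpleGraph (Fin r₂ ⊕ Fin r₃)} (hG : Admissible G)
    {j : Fin r₂} {k : Fin r₃} (h : G.Reachable (Sum.inl j) (Sum.inr k)) :
    G.Adj (Sum.inl j) (Sum.inr k) := by
  obtain ⟨a, b, ha, hb, ⟨φ⟩⟩ := hG.2 (G.connectedComponentMk (Sum.inl j))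
  set C := G.connectedComponentMk (Sum.inl j)
  let x : C := ⟨Sum.inl j, rfl⟩
  let y : C := ⟨Sum.inr k, (SimpleGraph.ConnectedComponent.eq.2 h).symm⟩
  have hno : ∀ z : C, ¬ (C.toSimpleGraph.Adj x z ∧ C.toSimpleGraph.Adj y z) := by
    rintro z ⟨hx, hy⟩
    have hx' : (completeBipartiteGraph (Fin r₂) (Fin r₃)).Adj (Sum.inl j) z := hG.1 hx
    have hy' : (completeBipartiteGraph (Fin r₂) (Fin r₃)).Adj (Sum.inr k) z := hG.1 hy
    rcases z with ⟨z | z, hz⟩ <;> simp at hx' hy'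
  have hxy : C.toSimpleGraph.Adj x y := by
    rw [← φ.map_adj_iff]
    rcases hx : φ x with s | s <;> rcases hy : φ y with t | t
    · refine absurd ?_ (hno (φ.symm (Sum.inr ⟨0, hb⟩)))
      rw [← φ.map_adj_iff, ← φ.map_adj_iff, hx, hy]
      simp
    · simp
    · simp
    · refine absurd ?_ (hno (φ.symm (Sum.inl ⟨0, ha⟩)))
      rw [← φ.map_adj_iff, ← φ.map_adj_iff, hx, hy]
      simp
  exact hxy

theorem Admissible.exists_adj {G : SimpleGraph (Fin r₂ ⊕ Fin r₃)} (hG : Admissible G)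
    (x : Fin r₂ ⊕ Fin r₃) : ∃ y, G.Adj x y := by
  obtain ⟨a, b, ha, hb, ⟨φ⟩⟩ := hG.2 (G.connectedComponentMk x)
  set C := G.connectedComponentMk x
  let x' : C := ⟨x, rfl⟩
  have key : ∀ t, (completeBipartiteGraph (Fin a) (Fin b)).Adj (φ x') t → ∃ y, G.Adj x y := by
    intro t ht
    refine ⟨φ.symm t, ?_⟩
    have : C.toSimpleGraph.Adj x' (φ.symm t) := by
      rw [← φ.map_adj_iff]
      simpa using ht
    exact this
  rcases hx : φ x' with s | s
  · exact key (Sum.inr ⟨0, hb⟩) (by rw [hx]; simp)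
  · exact key (Sum.inl ⟨0, ha⟩) (by rw [hx]; simp)

/-- The graph whose edges join the equally labelled vertices on opposite sides. -/
def labelGraph {γ : Type} (c : Fin r₂ ⊕ Fin r₃ → γ) : SimpleGraph (Fin r₂ ⊕ Fin r₃) where
  Adj x y := (completeBipartiteGraph (Fin r₂) (Fin r₃)).Adj x y ∧ c x = c y
  symm := ⟨fun _ _ h => ⟨h.1.symm, h.2.symm⟩⟩
  loopless := ⟨fun _ h => h.1.ne rfl⟩

theorem label_eq_of_reachable {γ : Type} {c : Fin r₂ ⊕ Fin r₃ → γ} {x y : Fin r₂ ⊕ Fin r₃}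
    (h : (labelGraph c).Reachable x y) : c x = c y := by
  obtain ⟨p⟩ := h
  induction p with
  | nil => rfl
  | cons h _ ih => exact h.2.trans ih

/-- Equally labelled vertices on one side have a common neighbour, because their label also occurs
on the other side. -/
theorem reachable_labelGraph_iff {γ : Type} {c : Fin r₂ ⊕ Fin r₃ → γ}
    (h₂ : ∀ j, ∃ k, c (Sum.inl j) = c (Sum.inr k)) (h₃ : ∀ k, ∃ j, c (Sum.inl j) = c (Sum.inr k))
    {x y : Fin r₂ ⊕ Fin r₃} : (labelGraph c).Reachable x y ↔ c x = c y := by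
  refine ⟨label_eq_of_reachable, fun h => ?_⟩
  have hadj : ∀ j k, c (Sum.inl j) = c (Sum.inr k) →
      (labelGraph c).Reachable (Sum.inl j) (Sum.inr k) := fun j k h =>
    SimpleGraph.Adj.reachable ⟨by simp, h⟩
  rcases x with j | k <;> rcases y with j' | k'
  · obtain ⟨k, hk⟩ := h₂ j
    exact (hadj j k hk).trans (hadj j' k (h.symm.trans hk)).symm
  · exact hadj j k' h
  · exact (hadj j' k h.symm).symm
  · obtain ⟨j, hj⟩ := h₃ k
    exact (hadj j k hj).symm.trans (hadj j k' (hj.trans h))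

theorem admissible_labelGraph {γ : Type} {c : Fin r₂ ⊕ Fin r₃ → γ}
    (h₂ : ∀ j, ∃ k, c (Sum.inl j) = c (Sum.inr k))
    (h₃ : ∀ k, ∃ j, c (Sum.inl j) = c (Sum.inr k)) : Admissible (labelGraph c) := by
  classical
  refine ⟨fun x y h => h.1, fun C => ?_⟩
  induction C using SimpleGraph.ConnectedComponent.ind with | _ x
  have hmem : ∀ y, y ∈ ((labelGraph c).connectedComponentMk x).supp ↔ c y = c x := fun y => by
    rw [SimpleGraph.ConnectedComponent.mem_supp_iff, SimpleGraph.ConnectedComponent.eq,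
      reachable_labelGraph_iff h₂ h₃]
  let A := {j : Fin r₂ // c (Sum.inl j) = c x}
  let B := {k : Fin r₃ // c (Sum.inr k) = c x}
  let e : ((labelGraph c).connectedComponentMk x).supp ≃
      Fin (Fintype.card A) ⊕ Fin (Fintype.card B) :=
    (Equiv.subtypeEquivRight hmem).trans (Equiv.subtypeSum.trans
      (Equiv.sumCongr (Fintype.equivFin A) (Fintype.equivFin B)))
  have hAB : Nonempty A ∧ Nonempty B := by
    rcases x with j | k
    · obtain ⟨k, hk⟩ := h₂ j
      exact ⟨⟨⟨j, rfl⟩⟩, ⟨⟨k, hk.symm⟩⟩⟩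
    · obtain ⟨j, hj⟩ := h₃ k
      exact ⟨⟨⟨j, hj⟩⟩, ⟨⟨k, rfl⟩⟩⟩
  refine ⟨Fintype.card A, Fintype.card B, Fintype.card_pos_iff.2 hAB.1,
    Fintype.card_pos_iff.2 hAB.2, ⟨⟨e, ?_⟩⟩⟩
  rintro ⟨y, hy⟩ ⟨z, hz⟩
  have hyz : c y = c z := ((hmem y).1 hy).trans ((hmem z).1 hz).symm
  have hadj : ((labelGraph c).connectedComponentMk x).toSimpleGraph.Adj ⟨y, hy⟩ ⟨z, hz⟩ ↔
      (completeBipartiteGraph (Fin r₂) (Fin r₃)).Adj y z := ⟨fun h => h.1, fun h => ⟨h, hyz⟩⟩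
  refine Iff.trans ?_ hadj.symm
  have hl : ∀ j hj, e ⟨Sum.inl j, hj⟩ = Sum.inl (Fintype.equivFin A ⟨j, (hmem _).1 hj⟩) :=
    fun _ _ => rfl
  have hr : ∀ k hk, e ⟨Sum.inr k, hk⟩ = Sum.inr (Fintype.equivFin B ⟨k, (hmem _).1 hk⟩) :=
    fun _ _ => rfl
  rcases y with y | y <;> rcases z with z | z <;> simp [hl, hr]

/-- The label of a column: the connected component of its first vertex. -/
def columnLabel (G : SimpleGraph (Fin r₂ ⊕ Fin r₃)) (v : Fin r₂ ×ₗ Fin r₃) :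
    G.ConnectedComponent :=
  G.connectedComponentMk (Sum.inl (ofLex v).1)

/-- The columns at the non-edges of a graph. -/
def nonEdges (G : SimpleGraph (Fin r₂ ⊕ Fin r₃)) : Set (Fin r₂ ×ₗ Fin r₃) :=
  {v | ¬ G.Adj (Sum.inl (ofLex v).1) (Sum.inr (ofLex v).2)}

theorem P_eq_labelIdeal {G : SimpleGraph (Fin r₂ ⊕ Fin r₃)} (hG : Admissible G) :
    P r₁ G = labelIdeal ℂ (Fin r₁) (columnLabel G) (nonEdges G) := by
  rw [P, P0, P1, labelIdeal]
  congr 2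
  · ext f
    constructor
    · rintro ⟨i, j, k, h, rfl⟩
      exact ⟨i, toLex (j, k), h, rfl⟩
    · rintro ⟨i, v, h, rfl⟩
      exact ⟨i, (ofLex v).1, (ofLex v).2, h, rfl⟩
  · ext f
    constructor
    · rintro ⟨C, i, i', j, j', k, k', hj, hj', hk, hk', rfl⟩
      rw [SimpleGraph.ConnectedComponent.mem_supp_iff] at hj hj' hk hk'
      refine ⟨i, i', toLex (j, k), toLex (j', k'), not_not.2 ?_, not_not.2 ?_,
        hj.trans hj'.symm, rfl⟩
      · exact hG.adj_of_reachable (SimpleGraph.ConnectedComponent.eq.1 (hj.trans hk.symm))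
      · exact hG.adj_of_reachable (SimpleGraph.ConnectedComponent.eq.1 (hj'.trans hk'.symm))
    · rintro ⟨i, i', v, w, hv, hw, hvw, rfl⟩
      have hv' := SimpleGraph.ConnectedComponent.eq.2 (not_not.1 hv).reachable
      have hw' := SimpleGraph.ConnectedComponent.eq.2 (not_not.1 hw).reachable
      exact ⟨columnLabel G v, i, i', (ofLex v).1, (ofLex w).1, (ofLex v).2, (ofLex w).2,
        rfl, hvw.symm, hv'.symm, hw'.symm.trans hvw.symm, rfl⟩

theorem isPrime_P {G : SimpleGraph (Fin r₂ ⊕ Fin r₃)} (hG : Admissible G) : (P r₁ G).IsPrime := by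
  rw [P_eq_labelIdeal hG]
  exact isPrime_labelIdeal _ _

theorem initialIdeal_P {G : SimpleGraph (Fin r₂ ⊕ Fin r₃)} (hG : Admissible G) :
    initialIdeal (degRevLex (Idx r₁ r₂ r₃)) (P r₁ G) =
      squarefreeIdeal ℂ (labelSupports (columnLabel G) (nonEdges G)) := by
  rw [P_eq_labelIdeal hG]
  exact initialIdeal_labelIdeal _ _

/-! ### Comparing the ideals `I_M` and `P_G` -/

theorem minor_mem_idealM (i i' : Fin r₁) {v w : Fin r₂ ×ₗ Fin r₃}
    (h : (ofLex v).1 = (ofLex w).1 ∨ (ofLex v).2 = (ofLex w).2) :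
    X (toLex (i, v)) * X (toLex (i', w)) - X (toLex (i, w)) * X (toLex (i', v)) ∈
      idealM r₁ r₂ r₃ := by
  obtain ⟨⟨j, k⟩, rfl⟩ := toLex.surjective v
  obtain ⟨⟨j', k'⟩, rfl⟩ := toLex.surjective w
  rcases h with h | h <;> simp only [ofLex_toLex] at h <;> subst h
  · exact Ideal.mem_sup_right (Ideal.subset_span ⟨i, i', j, k, k', rfl⟩)
  · exact Ideal.mem_sup_left (Ideal.subset_span ⟨i, i', j, j', k, rfl⟩)

theorem idealM_le_P {G : SimpleGraph (Fin r₂ ⊕ Fin r₃)} (hG : Admissible G) :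
    idealM r₁ r₂ r₃ ≤ P r₁ G := by
  rw [P_eq_labelIdeal hG]
  refine sup_le (Ideal.span_le.2 ?_) (Ideal.span_le.2 ?_)
  · rintro _ ⟨i, i', j, j', k, rfl⟩
    refine minor_mem_labelIdeal (v := toLex (j, k)) (w := toLex (j', k)) (fun hv hw => ?_) i i'
    exact SimpleGraph.ConnectedComponent.eq.2
      ((not_not.1 hv).reachable.trans (not_not.1 hw).reachable.symm)
  · rintro _ ⟨i, i', j, k, k', rfl⟩
    exact minor_mem_labelIdeal (v := toLex (j, k)) (w := toLex (j, k')) (fun _ _ => rfl) i i'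

/-- If `P_G ≤ P_G'`, the variables in `P_G` force the edges of `G'` into `G`, and the minors force
the converse. -/
theorem not_P_le_P (h₁ : 2 ≤ r₁) {G G' : SimpleGraph (Fin r₂ ⊕ Fin r₃)} (hG : Admissible G)
    (hG' : Admissible G') (hne : G ≠ G') : ¬ P r₁ G ≤ P r₁ G' := by
  intro hle
  rw [P_eq_labelIdeal hG, P_eq_labelIdeal hG'] at hle
  have hsub : ∀ j k, G'.Adj (Sum.inl j) (Sum.inr k) → G.Adj (Sum.inl j) (Sum.inr k) := by
    intro j k h'
    by_contra h
    have hX : X (toLex ((⟨0, by omega⟩ : Fin r₁), toLex (j, k))) ∈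
        labelIdeal ℂ (Fin r₁) (columnLabel G) (nonEdges G) :=
      Ideal.mem_sup_left (Ideal.subset_span ⟨_, toLex (j, k), h, rfl⟩)
    exact mem_of_X_mem_labelIdeal (hle hX) h'
  have hsub' : ∀ j k, G.Adj (Sum.inl j) (Sum.inr k) → G'.Adj (Sum.inl j) (Sum.inr k) := by
    intro j k h
    -- The column `(j, k)` may be killed by `P_G'`, so the minor is taken on the `G'`-edges `(j,
    -- k')` and `(j', k)`, which lie in one component of `G`.
    obtain ⟨k' | k', hk⟩ := hG'.exists_adj (Sum.inl j)
    · simpa using hG'.1 hk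
    obtain ⟨j' | j', hj⟩ := hG'.exists_adj (Sum.inr k)
    swap
    · simpa using hG'.1 hj
    have hlabel : columnLabel G (toLex (j, k')) = columnLabel G (toLex (j', k)) :=
      SimpleGraph.ConnectedComponent.eq.2 (h.reachable.trans (hsub _ _ hj.symm).reachable.symm)
    have hlabel' := label_eq_of_minor_mem_labelIdeal (i := (⟨0, by omega⟩ : Fin r₁))
      (i' := ⟨1, by omega⟩) (by simp) (not_not.2 hk) (not_not.2 hj.symm)
      (hle (minor_mem_labelIdeal (fun _ _ => hlabel) _ _))
    exact hG'.adj_of_reachable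
      ((SimpleGraph.ConnectedComponent.eq.1 hlabel').trans hj.symm.reachable)
  apply hne
  ext x y
  rcases x with j | k <;> rcases y with j' | k'
  · exact iff_of_false (fun h => by simpa using hG.1 h) (fun h => by simpa using hG'.1 h)
  · exact ⟨hsub' _ _, hsub _ _⟩
  · exact ⟨fun h => (hsub' _ _ h.symm).symm, fun h => (hsub _ _ h.symm).symm⟩
  · exact iff_of_false (fun h => by simpa using hG.1 h) (fun h => by simpa using hG'.1 h)

/-- Any set of columns extends to a labelling of the vertices in which the components of the set
remain distinct and every label occurs on both sides. -/
theorem exists_label (h₂ : 1 ≤ r₂) (h₃ : 1 ≤ r₃) (E : Set (Fin r₂ ×ₗ Fin r₃))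
    {r : Fin r₂ ×ₗ Fin r₃ → Fin r₂ ×ₗ Fin r₃ → Prop}
    (hr : ∀ a ∈ E, ∀ b ∈ E, (ofLex a).1 = (ofLex b).1 ∨ (ofLex a).2 = (ofLex b).2 → r a b) :
    ∃ c : Fin r₂ ⊕ Fin r₃ → Quot r,
      (∀ v ∈ E, c (Sum.inl (ofLex v).1) = Quot.mk r v ∧ c (Sum.inr (ofLex v).2) = Quot.mk r v) ∧
      (∀ j, ∃ k, c (Sum.inl j) = c (Sum.inr k)) ∧ ∀ k, ∃ j, c (Sum.inl j) = c (Sum.inr k) := by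
  classical
  -- Vertices not met by `E` receive the label of `v₀`. Taking `v₀` in `E` when possible ensures
  -- that this label occurs on both sides; if `E` is empty, all vertices share it.
  obtain ⟨v₀, hv₀⟩ : ∃ v₀, E.Nonempty → v₀ ∈ E := by
    by_cases hE : E.Nonempty
    · exact ⟨hE.some, fun _ => hE.some_mem⟩
    · exact ⟨toLex (⟨0, h₂⟩, ⟨0, h₃⟩), fun h => absurd h hE⟩
  let c₂ : Fin r₂ → Fin r₂ ×ₗ Fin r₃ := fun j =>
    if h : ∃ v ∈ E, (ofLex v).1 = j then h.choose else v₀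
  let c₃ : Fin r₃ → Fin r₂ ×ₗ Fin r₃ := fun k =>
    if h : ∃ v ∈ E, (ofLex v).2 = k then h.choose else v₀
  have hc₂ : ∀ v ∈ E, Quot.mk r (c₂ (ofLex v).1) = Quot.mk r v := by
    intro v hv
    have h : ∃ w ∈ E, (ofLex w).1 = (ofLex v).1 := ⟨v, hv, rfl⟩
    simp only [c₂, dif_pos h]
    exact Quot.sound (hr _ h.choose_spec.1 v hv (Or.inl h.choose_spec.2))
  have hc₃ : ∀ v ∈ E, Quot.mk r (c₃ (ofLex v).2) = Quot.mk r v := by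
    intro v hv
    have h : ∃ w ∈ E, (ofLex w).2 = (ofLex v).2 := ⟨v, hv, rfl⟩
    simp only [c₃, dif_pos h]
    exact Quot.sound (hr _ h.choose_spec.1 v hv (Or.inr h.choose_spec.2))
  have h₀ : Quot.mk r (c₂ (ofLex v₀).1) = Quot.mk r v₀ ∧
      Quot.mk r (c₃ (ofLex v₀).2) = Quot.mk r v₀ := by
    by_cases hE : E.Nonempty
    · exact ⟨hc₂ _ (hv₀ hE), hc₃ _ (hv₀ hE)⟩
    · have h2 : ¬ ∃ v ∈ E, (ofLex v).1 = (ofLex v₀).1 := fun ⟨v, hv, _⟩ => hE ⟨v, hv⟩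
      have h3 : ¬ ∃ v ∈ E, (ofLex v).2 = (ofLex v₀).2 := fun ⟨v, hv, _⟩ => hE ⟨v, hv⟩
      simp only [c₂, c₃, dif_neg h2, dif_neg h3, and_self]
  refine ⟨Sum.elim (fun j => Quot.mk r (c₂ j)) (fun k => Quot.mk r (c₃ k)),
    fun v hv => ⟨hc₂ v hv, hc₃ v hv⟩, fun j => ?_, fun k => ?_⟩
  · by_cases h : ∃ v ∈ E, (ofLex v).1 = j
    · obtain ⟨v, hv, rfl⟩ := h
      exact ⟨(ofLex v).2, (hc₂ v hv).trans (hc₃ v hv).symm⟩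
    · refine ⟨(ofLex v₀).2, Eq.trans ?_ h₀.2.symm⟩
      simp only [Sum.elim_inl, c₂, dif_neg h]
  · by_cases h : ∃ v ∈ E, (ofLex v).2 = k
    · obtain ⟨v, hv, rfl⟩ := h
      exact ⟨(ofLex v).1, (hc₂ v hv).trans (hc₃ v hv).symm⟩
    · refine ⟨(ofLex v₀).1, h₀.1.trans ?_⟩
      simp only [Sum.elim_inr, c₃, dif_neg h]

/-- The supports of the leading exponents of `idealM`. -/
def admissibleSupports (r₁ r₂ r₃ : ℕ) : Set (Finset (Idx r₁ r₂ r₃)) :=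
  {s | ∀ G : SimpleGraph (Fin r₂ ⊕ Fin r₃), Admissible G →
    s ∈ labelSupports (columnLabel G) (nonEdges G)}

theorem isUpperSet_admissibleSupports : IsUpperSet (admissibleSupports r₁ r₂ r₃) :=
  fun _ _ hst hs G hG => isUpperSet_labelSupports _ _ hst (hs G hG)

/-- The hypothesis is needed at a single graph, the one adapted to the columns of `u`. -/
theorem exists_mem_idealM_leadingTerm (h₂ : 1 ≤ r₂) (h₃ : 1 ≤ r₃) {u : Idx r₁ r₂ r₃ →₀ ℕ}
    (hu : u.support ∈ admissibleSupports r₁ r₂ r₃) :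
    ∃ g ∈ idealM r₁ r₂ r₃, (degRevLex (Idx r₁ r₂ r₃)).leadingTerm g = monomial u 1 := by
  let E : Set (Fin r₂ ×ₗ Fin r₃) := {v | ∃ i, u (toLex (i, v)) ≠ 0}
  let r : Fin r₂ ×ₗ Fin r₃ → Fin r₂ ×ₗ Fin r₃ → Prop := fun a b =>
    a ∈ E ∧ b ∈ E ∧ ((ofLex a).1 = (ofLex b).1 ∨ (ofLex a).2 = (ofLex b).2)
  obtain ⟨c, hc, hc₂, hc₃⟩ := exists_label h₂ h₃ E (r := r) fun a ha b hb h => ⟨ha, hb, h⟩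
  rcases hu _ (admissible_labelGraph hc₂ hc₃) with
    ⟨x, hx, hxZ⟩ | ⟨i, i', a, b, hi, hab, -, -, hχ, hb, ha⟩
  · have hxE : (ofLex x).2 ∈ E := ⟨(ofLex x).1, Finsupp.mem_support_iff.1 hx⟩
    -- Every column of `u` is an edge of this graph, so the alternative of a killed column is void.
    exact absurd ⟨by simp, (hc _ hxE).1.trans (hc _ hxE).2.symm⟩ hxZ
  · rw [Finsupp.mem_support_iff] at ha hb
    have haE : a ∈ E := ⟨i', ha⟩
    have hbE : b ∈ E := ⟨i, hb⟩
    -- The labels are classes of `r`, so equal labels give a chain of linked columns inside `E`.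
    have hba : Relation.EqvGen r b a := Quot.eqvGen_exact <| by
      rw [← (hc a haE).1, ← (hc b hbE).1]
      exact (label_eq_of_reachable (SimpleGraph.ConnectedComponent.eq.1 hχ)).symm
    obtain ⟨M, hM, hlt⟩ := exists_leadingTerm_antidiagonal (K := ℂ) hi hab hb ha
    refine ⟨_, (exchange_mem (fun a b h => ⟨h.1, h.2.1⟩)
      (fun a b h i i' => minor_mem_idealM i i' h.2.2) hba).2 hbE M i i' ?_, hlt⟩
    rintro e ⟨l, hl⟩
    by_cases heb : e = b
    · exact Or.inl heb
    by_cases hea : e = a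
    · exact Or.inr (Or.inl hea)
    refine Or.inr (Or.inr ⟨l, ?_⟩)
    simpa [hM, Ne.symm heb, Ne.symm hea, Finsupp.single_apply] using hl

/-- A prime containing a finite intersection contains one of its members, against `not_P_le_P`. -/
theorem iInf_ne_idealM (h₁ : 2 ≤ r₁) {G : SimpleGraph (Fin r₂ ⊕ Fin r₃)} (hG : Admissible G) :
    (⨅ (G' : SimpleGraph (Fin r₂ ⊕ Fin r₃)) (_ : Admissible G') (_ : G' ≠ G), P r₁ G') ≠
      idealM r₁ r₂ r₃ := by
  classical
  intro h
  have hle : (Finset.univ.filter fun G' : SimpleGraph (Fin r₂ ⊕ Fin r₃) =>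
      Admissible G' ∧ G' ≠ G).inf (P r₁) ≤ P r₁ G := by
    refine le_trans (le_iInf fun G' => le_iInf fun hG' => le_iInf fun hne => ?_)
      (h.trans_le (idealM_le_P hG))
    exact Finset.inf_le (by simp [hG', hne])
  obtain ⟨G', hG', hle'⟩ := ((isPrime_P hG).inf_le').1 hle
  simp only [Finset.mem_filter, Finset.mem_univ, true_and] at hG'
  exact not_P_le_P h₁ hG'.1 hG hG'.2 hle'

end CondIndep

/-! ### The main theorem -/

theorem mainTheorem1 (r₁ r₂ r₃ : ℕ) (h₁ : 2 ≤ r₁) (h₂ : 1 ≤ r₂) (h₃ : 1 ≤ r₃) :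
    -- the decomposition into primes
    CondIndep.idealM r₁ r₂ r₃ =
        (⨅ (G : SimpleGraph (Fin r₂ ⊕ Fin r₃)) (_ : CondIndep.Admissible G), CondIndep.P r₁ G) ∧
    (∀ G : SimpleGraph (Fin r₂ ⊕ Fin r₃), CondIndep.Admissible G → (CondIndep.P r₁ G).IsPrime) ∧
    -- irredundance: no component can be omitted, and no component contains another one
    (∀ G : SimpleGraph (Fin r₂ ⊕ Fin r₃), CondIndep.Admissible G →
      (⨅ (G' : SimpleGraph (Fin r₂ ⊕ Fin r₃)) (_ : CondIndep.Admissible G') (_ : G' ≠ G),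
        CondIndep.P r₁ G') ≠ CondIndep.idealM r₁ r₂ r₃) ∧
    (∀ G G' : SimpleGraph (Fin r₂ ⊕ Fin r₃), CondIndep.Admissible G → CondIndep.Admissible G' →
      G ≠ G' → ¬ CondIndep.P r₁ G ≤ CondIndep.P r₁ G') ∧
    -- the initial ideals
    initialIdeal (degRevLex (CondIndep.Idx r₁ r₂ r₃)) (CondIndep.idealM r₁ r₂ r₃) =
        initialIdeal (degRevLex (CondIndep.Idx r₁ r₂ r₃))
          (⨅ (G : SimpleGraph (Fin r₂ ⊕ Fin r₃)) (_ : CondIndep.Admissible G),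
            CondIndep.P r₁ G) ∧
    initialIdeal (degRevLex (CondIndep.Idx r₁ r₂ r₃))
          (⨅ (G : SimpleGraph (Fin r₂ ⊕ Fin r₃)) (_ : CondIndep.Admissible G),
            CondIndep.P r₁ G) =
        (⨅ (G : SimpleGraph (Fin r₂ ⊕ Fin r₃)) (_ : CondIndep.Admissible G),
          initialIdeal (degRevLex (CondIndep.Idx r₁ r₂ r₃)) (CondIndep.P r₁ G)) ∧
    (∀ G : SimpleGraph (Fin r₂ ⊕ Fin r₃), CondIndep.Admissible G →
      IsSquarefreeMonomialIdeal
        (initialIdeal (degRevLex (CondIndep.Idx r₁ r₂ r₃)) (CondIndep.P r₁ G))) ∧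
    -- radicality
    (initialIdeal (degRevLex (CondIndep.Idx r₁ r₂ r₃)) (CondIndep.idealM r₁ r₂ r₃)).IsRadical ∧
    (CondIndep.idealM r₁ r₂ r₃).IsRadical := by
  have hmem : ∀ f ∈ (⨅ (G : SimpleGraph (Fin r₂ ⊕ Fin r₃)) (_ : CondIndep.Admissible G),
      CondIndep.P r₁ G), f ≠ 0 → ((degRevLex (CondIndep.Idx r₁ r₂ r₃)).degree f).support ∈
        CondIndep.admissibleSupports r₁ r₂ r₃ := by
    intro f hf hf0 G hG
    simp only [Submodule.mem_iInf] at hf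
    have hfG := hf G hG
    rw [CondIndep.P_eq_labelIdeal hG] at hfG
    exact support_degree_mem_labelSupports (labelIdeal_le_ker _ _ hfG) hf0
  have hle : CondIndep.idealM r₁ r₂ r₃ ≤
      ⨅ (G : SimpleGraph (Fin r₂ ⊕ Fin r₃)) (_ : CondIndep.Admissible G), CondIndep.P r₁ G :=
    le_iInf fun G => le_iInf fun hG => CondIndep.idealM_le_P hG
  have hlead : ∀ u : CondIndep.Idx r₁ r₂ r₃ →₀ ℕ,
      u.support ∈ CondIndep.admissibleSupports r₁ r₂ r₃ → ∃ g ∈ CondIndep.idealM r₁ r₂ r₃,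
        (degRevLex (CondIndep.Idx r₁ r₂ r₃)).leadingTerm g = MvPolynomial.monomial u 1 :=
    fun u hu => CondIndep.exists_mem_idealM_leadingTerm h₂ h₃ hu
  have hM := le_antisymm hle (le_of_leadingTerm_eq_monomial hle hmem hlead)
  have hin := initialIdeal_eq_squarefreeIdeal (fun f hf => hmem f (hle hf)) hlead
  refine ⟨hM, fun G hG => CondIndep.isPrime_P hG, fun G hG => CondIndep.iInf_ne_idealM h₁ hG,
    fun G G' hG hG' hne => CondIndep.not_P_le_P h₁ hG hG' hne, by rw [← hM], ?_,
    fun G hG => ?_, ?_, ?_⟩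
  -- Membership in these monomial ideals is tested on each exponent separately, so intersecting the
  -- support sets intersects the ideals.
  · rw [← hM, hin]
    ext f
    simp only [Submodule.mem_iInf]
    rw [mem_squarefreeIdeal CondIndep.isUpperSet_admissibleSupports]
    constructor
    · intro h G hG
      rw [CondIndep.initialIdeal_P hG, mem_squarefreeIdeal (isUpperSet_labelSupports _ _)]
      exact fun u hu => h u hu G hG
    · intro h u hu G hG
      have hG' := h G hG
      rw [CondIndep.initialIdeal_P hG, mem_squarefreeIdeal (isUpperSet_labelSupports _ _)] at hG'
      exact hG' u hu
  · rw [CondIndep.initialIdeal_P hG]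
    exact isSquarefreeMonomialIdeal_squarefreeIdeal _
  · rw [hin]
    exact isRadical_squarefreeIdeal (degRevLex (CondIndep.Idx r₁ r₂ r₃))
      CondIndep.isUpperSet_admissibleSupports
  · rw [hM]
    exact Ideal.isRadical_iInf _ fun G => Ideal.isRadical_iInf _ fun hG =>
      (CondIndep.isPrime_P hG).isRadical
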